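/- Let $m\ge 0$, let $(B,g_B)$ and $(F_1,g_{F_1}),\dots,(F_m,g_{F_m})$ be connected, finite-dimensional smooth pseudo-Riemannian manifolds (without boundary) with $\dim F_i>1$ for every $i$, and let $b_i: B\times F_i\to(0,\infty)$, $1\le i\le m$, be smooth functions. Let $M=B\times_{b_1}F_1\times_{b_2}\cdots\times_{b_m}F_m$ be the multiply twisted product, i.e. the product manifold $M=B\times F_1\times\cdots\times F_m$ with the metric $$g=g_B\oplus b_1^2\,g_{F_1}\oplus\cdots\oplus b_m^2\,g_{F_m},$$ where $b_i$ is evaluated at the $B$- and $F_i$-components of the point. Let $\mathrm{Ric}$ be the Ricci tensor of the Levi-Civita connection of $g$. Call $M$ *mixed Ricci-flat* if, at every point of $M$, $\mathrm{Ric}(X,V)=0$ for every $X$ tangent to $B$ and every $V$ tangent to one of the fibers $F_i$. Say that $M$ *can be expressed as a multiply warped product* if there are smooth functions $\beta_i: B\to(0,\infty)$ and smooth pseudo-Riemannian metrics $h_i$ on $F_i$ $(1\le i\le m)$ such that $$g=g_B\oplus\beta_1^2\,h_1\oplus\cdots\oplus\beta_m^2\,h_m .$$ Then $M$ is mixed Ricci-flat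 if and only if $M$ can be expressed as a multiply warped product. In particular, if $M$ is Einstein, i.e. $\mathrm{Ric}=c\,g$ for some constant $c\in\mathbb{R}$, then $M$ can be expressed as a multiply warped product. -/

import Mathlib

set_option maxSynthPendingDepth 3

open scoped Manifold ContDiff Bundle

noncomputable section

namespace TwistedProduct

/-! ### Ricci curvature of a metric given by its components on a coordinate domain -/

section Coordinates

variable {E : Type*} [NormedAddCommGroup E] [NormedSpace ℝ E]

/-- The Christoffel symbols of the first kind of `G : E → (E →L[ℝ] E →L[ℝ] ℝ)` at `z`, as a
trilinear form: `Γ(u, v, w) = ½ (∂ᵤ G(v, w) + ∂ᵥ G(u, w) - ∂_w G(u, v))`. -/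
def christoffelFirst (G : E → E →L[ℝ] E →L[ℝ] ℝ) (z : E) : E →L[ℝ] E →L[ℝ] E →L[ℝ] ℝ :=
  (1 / 2 : ℝ) • (fderiv ℝ G z + (fderiv ℝ G z).flip -
    (ContinuousLinearMap.flipₗᵢ ℝ E E ℝ).toContinuousLinearEquiv.toContinuousLinearMap ∘L
      (fderiv ℝ G z).flip)

theorem christoffelFirst_apply (G : E → E →L[ℝ] E →L[ℝ] ℝ) (z u v w : E) :
    christoffelFirst G z u v w =
      (1 / 2 : ℝ) * (fderiv ℝ G z u v w + fderiv ℝ G z v u w - fderiv ℝ G z w u v) := by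
  simp [christoffelFirst]

/-- The Christoffel symbols of the second kind: for constant coordinate fields `u`, `v`, the
vector `christoffel G z u v` is `∇ᵤ v` at `z`, the solution `x` of
`G z x w = christoffelFirst G z u v w` for all `w` (where `G z` is nondegenerate). -/
def christoffel (G : E → E →L[ℝ] E →L[ℝ] ℝ) (z : E) : E →L[ℝ] E →L[ℝ] E :=
  ContinuousLinearMap.compL ℝ E (E →L[ℝ] ℝ) E (G z).inverse ∘L christoffelFirst G z

theorem christoffel_apply (G : E → E →L[ℝ] E →L[ℝ] ℝ) (z u v : E) :
    christoffel G z u v = (G z).inverse (christoffelFirst G z u v) := rfl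

theorem metric_christoffel [FiniteDimensional ℝ E] (G : E → E →L[ℝ] E →L[ℝ] ℝ) (z : E)
    (hG : ∀ v, (∀ w, G z v w = 0) → v = 0) (u v w : E) :
    G z (christoffel G z u v) w = christoffelFirst G z u v w := by
  have hinj : Function.Injective (G z) := by
    rw [injective_iff_map_eq_zero]
    exact fun a ha => hG a fun w => by rw [ha]; rfl
  have hdim : Module.finrank ℝ E = Module.finrank ℝ (E →L[ℝ] ℝ) := by
    rw [← (LinearMap.toContinuousLinearMap (𝕜 := ℝ) (E := E) (F' := ℝ)).finrank_eq]
    exact (Subspace.dual_finrank_eq (K := ℝ) (V := E)).symm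
  let e : E ≃L[ℝ] (E →L[ℝ] ℝ) :=
    (LinearEquiv.ofInjectiveOfFinrankEq (G z : E →ₗ[ℝ] (E →L[ℝ] ℝ)) hinj
      hdim).toContinuousLinearEquiv
  have he : (e : E →L[ℝ] (E →L[ℝ] ℝ)) = G z := by
    ext a b
    rfl
  rw [christoffel_apply, ← he, ContinuousLinearMap.inverse_equiv]
  simp

/-- The curvature `R(u, v) w = ∇ᵤ ∇ᵥ w - ∇ᵥ ∇ᵤ w - ∇_[u, v] w` at `z`, evaluated on constant
coordinate fields (so `[u, v] = 0`), as a linear map of `v`. -/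
def curvature (G : E → E →L[ℝ] E →L[ℝ] ℝ) (z u w : E) : E →ₗ[ℝ] E where
  toFun v :=
    (fderiv ℝ (christoffel G) z u v w + christoffel G z u (christoffel G z v w)) -
      (fderiv ℝ (christoffel G) z v u w + christoffel G z v (christoffel G z u w))
  map_add' a b := by simp; abel
  map_smul' c a := by simp [smul_sub, smul_add]

/-- The Ricci curvature `Ric(u, w) = ∑ₖ εₖ ⟨R(u, Eₖ) w, Eₖ⟩`, i.e. the trace of
`v ↦ R(u, v) w`. -/
def ricciCoord (G : E → E →L[ℝ] E →L[ℝ] ℝ) (z u w : E) : ℝ :=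
  LinearMap.trace ℝ E (curvature G z u w)

end Coordinates

/-! ### Fields of bilinear forms, pseudo-Riemannian metrics and Ricci curvature on manifolds -/

section Manifold

variable {E : Type*} [NormedAddCommGroup E] [NormedSpace ℝ E]
  {H : Type*} [TopologicalSpace H] (I : ModelWithCorners ℝ E H)
  (M : Type*) [TopologicalSpace M] [ChartedSpace H M]

/-- A (not necessarily smooth) field of bilinear forms on the tangent spaces of `M`. -/
abbrev BilinField : Type _ :=
  (x : M) → TangentSpace I x →L[ℝ] TangentSpace I x →L[ℝ] ℝ

/-- A smooth pseudo-Riemannian metric on `M`: a smooth field of symmetric nondegenerate bilinear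
forms on the tangent spaces. -/
structure PseudoRiemannianMetric [IsManifold I ∞ M] where
  /-- The scalar product on each tangent space. -/
  val : BilinField I M
  symm (x : M) (v w : TangentSpace I x) : val x v w = val x w v
  nondegenerate (x : M) (v : TangentSpace I x) (hv : ∀ w, val x v w = 0) : v = 0
  contMDiff : ContMDiff I (I.prod 𝓘(ℝ, E →L[ℝ] E →L[ℝ] ℝ)) ∞
    (fun x ↦ Bundle.TotalSpace.mk' (E →L[ℝ] E →L[ℝ] ℝ) (E := fun x : M ↦
      TangentSpace I x →L[ℝ] TangentSpace I x →L[ℝ] ℝ) x (val x))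

variable {M}

/-- The map `E → T_q M` that sends the components of a vector in the chart at `p` to the vector
itself, where `q` is the point with coordinates `z` in the chart at `p`; as always in Mathlib,
`T_q M` is `E`, through the chart at `q`. -/
def chartFrame (p : M) (z : E) : E →L[ℝ] TangentSpace I ((extChartAt I p).symm z) :=
  fderivWithin ℝ (extChartAt I ((extChartAt I p).symm z) ∘ (extChartAt I p).symm) (Set.range I) z

theorem chartFrame_eq_tangentCoordChange [IsManifold I 1 M] (p : M) {z : E}
    (hz : z ∈ (extChartAt I p).target) :
    chartFrame I p z =
      tangentCoordChange I p ((extChartAt I p).symm z) ((extChartAt I p).symm z) := by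
  rw [tangentCoordChange_def, (extChartAt I p).right_inv hz]
  rfl

variable {I}

/-- The components of the field `g` in the chart at `p`, as a function of the coordinates. -/
def chartComponents (g : BilinField I M) (p : M) (z : E) : E →L[ℝ] E →L[ℝ] ℝ :=
  letI G : E →L[ℝ] E →L[ℝ] ℝ := g ((extChartAt I p).symm z)
  G.bilinearComp (chartFrame I p z) (chartFrame I p z)

/-- The Ricci tensor at `p` of the Levi-Civita connection of `g`, computed in the chart at `p`
(in which `T_p M = E`). -/
def ricci (g : BilinField I M) (p : M) (u v : TangentSpace I p) : ℝ :=
  ricciCoord (chartComponents g p) (extChartAt I p p) u v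

/-- The metric `g` is Einstein: `Ric = c g` for some constant `c`. -/
def IsEinstein (g : BilinField I M) : Prop :=
  ∃ c : ℝ, ∀ (p : M) (u v : TangentSpace I p), ricci g p u v = c * g p u v

end Manifold

/-! ### Multiply twisted and multiply warped products -/

section Products

variable {m : ℕ}
  {EB : Type*} [NormedAddCommGroup EB] [NormedSpace ℝ EB]
  {B : Type*} [TopologicalSpace B] [ChartedSpace EB B]
  {E : Fin m → Type*} [∀ i, NormedAddCommGroup (E i)] [∀ i, NormedSpace ℝ (E i)]
  {F : Fin m → Type*} [∀ i, TopologicalSpace (F i)] [∀ i, ChartedSpace (E i) (F i)]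

/-- The model with corners of the product manifold `B × F₁ × ⋯ × Fₘ`. -/
abbrev prodModel (EB : Type*) [NormedAddCommGroup EB] [NormedSpace ℝ EB] {m : ℕ}
    (E : Fin m → Type*) [∀ i, NormedAddCommGroup (E i)] [∀ i, NormedSpace ℝ (E i)] :
    ModelWithCorners ℝ (EB × ∀ i, E i) (ModelProd EB (ModelPi E)) :=
  (𝓘(ℝ, EB)).prod (ModelWithCorners.pi fun i ↦ 𝓘(ℝ, E i))

/-- The bilinear form `G_B ⊕ c₁ G₁ ⊕ ⋯ ⊕ cₘ Gₘ` on `EB × E₁ × ⋯ × Eₘ`. -/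
def sumForm (GB : EB →L[ℝ] EB →L[ℝ] ℝ) (G : ∀ i, E i →L[ℝ] E i →L[ℝ] ℝ) (c : Fin m → ℝ) :
    (EB × ∀ i, E i) →L[ℝ] (EB × ∀ i, E i) →L[ℝ] ℝ :=
  GB.bilinearComp (ContinuousLinearMap.fst ℝ EB (∀ i, E i))
      (ContinuousLinearMap.fst ℝ EB (∀ i, E i)) +
    ∑ i, c i • (G i).bilinearComp
      (ContinuousLinearMap.proj i ∘L ContinuousLinearMap.snd ℝ EB (∀ i, E i))
      (ContinuousLinearMap.proj i ∘L ContinuousLinearMap.snd ℝ EB (∀ i, E i))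

theorem sumForm_apply (GB : EB →L[ℝ] EB →L[ℝ] ℝ) (G : ∀ i, E i →L[ℝ] E i →L[ℝ] ℝ)
    (c : Fin m → ℝ) (u v : EB × ∀ i, E i) :
    sumForm GB G c u v = GB u.1 v.1 + ∑ i, c i * G i (u.2 i) (v.2 i) := by
  simp [sumForm]

/-- The field `g = g_B ⊕ b₁² g_{F₁} ⊕ ⋯ ⊕ bₘ² g_{Fₘ}` on `B × F₁ × ⋯ × Fₘ`, whose tangent space
at `(x, y₁, …, yₘ)` is `T_x B × T_{y₁} F₁ × ⋯ × T_{yₘ} Fₘ`. -/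
def twistedMetric (gB : BilinField 𝓘(ℝ, EB) B) (gF : ∀ i, BilinField 𝓘(ℝ, E i) (F i))
    (b : ∀ i, B × F i → ℝ) : BilinField (prodModel EB E) (B × ∀ i, F i) := fun p ↦
  sumForm (gB p.1) (fun i ↦ gF i (p.2 i)) (fun i ↦ b i (p.1, p.2 i) ^ 2)

/-- A field on `B × F₁ × ⋯ × Fₘ` is mixed Ricci-flat: `Ric(X, V) = 0` for all `X` tangent to `B`
and all `V` tangent to one of the fibers `Fᵢ`. -/
def IsMixedRicciFlat (g : BilinField (prodModel EB E) (B × ∀ i, F i)) : Prop :=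
  ∀ (p : B × ∀ i, F i) (X : TangentSpace 𝓘(ℝ, EB) p.1) (i : Fin m)
    (V : TangentSpace 𝓘(ℝ, E i) (p.2 i)),
    ricci g p ((X, 0) : EB × ∀ i, E i) ((0, Pi.single i V) : EB × ∀ i, E i) = 0

/-- The field `g` on `B × F₁ × ⋯ × Fₘ` is the metric of a multiply warped product of `(B, g_B)`
and of the `Fᵢ` with some metrics: there are smooth `βᵢ : B → (0, ∞)` and
pseudo-Riemannian metrics `hᵢ` on `Fᵢ` with `g = g_B ⊕ β₁² h₁ ⊕ ⋯ ⊕ βₘ² hₘ`. -/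
def IsMultiplyWarped [IsManifold 𝓘(ℝ, EB) ∞ B] [∀ i, IsManifold 𝓘(ℝ, E i) ∞ (F i)]
    (gB : PseudoRiemannianMetric 𝓘(ℝ, EB) B)
    (g : BilinField (prodModel EB E) (B × ∀ i, F i)) : Prop :=
  ∃ (β : Fin m → B → ℝ) (h : ∀ i, PseudoRiemannianMetric 𝓘(ℝ, E i) (F i)),
    (∀ i x, 0 < β i x) ∧ (∀ i, ContMDiff 𝓘(ℝ, EB) 𝓘(ℝ, ℝ) ∞ (β i)) ∧
      g = twistedMetric gB.val (fun i ↦ (h i).val) (fun i q ↦ β i q.1)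

end Products

end TwistedProduct

end

open scoped Manifold ContDiff Bundle

noncomputable section

namespace TwistedProduct

open Filter Topology

section LocalMetric

variable {E : Type*} [NormedAddCommGroup E] [NormedSpace ℝ E]

/-- `G` restricts to a `C²` field of symmetric nondegenerate bilinear forms near `z`. -/
structure IsLocalMetric (G : E → E →L[ℝ] E →L[ℝ] ℝ) (z : E) : Prop where
  contDiffAt : ContDiffAt ℝ 2 G z
  symm : ∀ᶠ x in 𝓝 z, ∀ v w, G x v w = G x w v
  nondegenerate : ∀ᶠ x in 𝓝 z, ∀ v, (∀ w, G x v w = 0) → v = 0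

theorem IsLocalMetric.eventually {G : E → E →L[ℝ] E →L[ℝ] ℝ} {z : E} (h : IsLocalMetric G z) :
    ∀ᶠ x in 𝓝 z, IsLocalMetric G x := by
  filter_upwards [h.contDiffAt.eventually (by decide), h.symm.eventually_nhds,
    h.nondegenerate.eventually_nhds] with x h₁ h₂ h₃
  exact ⟨h₁, h₂, h₃⟩

theorem IsLocalMetric.differentiableAt {G : E → E →L[ℝ] E →L[ℝ] ℝ} {z : E}
    (h : IsLocalMetric G z) : DifferentiableAt ℝ G z :=
  h.contDiffAt.differentiableAt (by decide)

theorem fderiv_clm_apply₂ {F F' F'' : Type*} [NormedAddCommGroup F] [NormedSpace ℝ F]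
    [NormedAddCommGroup F'] [NormedSpace ℝ F'] [NormedAddCommGroup F''] [NormedSpace ℝ F'']
    {G : E → F →L[ℝ] F' →L[ℝ] F''} {z : E} (h : DifferentiableAt ℝ G z) (u : E) (v : F) (w : F') :
    fderiv ℝ G z u v w = fderiv ℝ (fun x ↦ G x v w) z u := by
  have h₁ := (h.hasFDerivAt.clm_apply (hasFDerivAt_const v z)).clm_apply (hasFDerivAt_const w z)
  rw [h₁.fderiv]
  simp

/-- The Ricci curvature at `z` depends only on the germ of the metric at `z`. -/
theorem ricciCoord_congr {G G' : E → E →L[ℝ] E →L[ℝ] ℝ} {z : E} (h : G =ᶠ[𝓝 z] G') :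
    ricciCoord G z = ricciCoord G' z := by
  have hc : christoffel G =ᶠ[𝓝 z] christoffel G' := by
    filter_upwards [h.eventually_nhds] with x hx
    have hx : G =ᶠ[𝓝 x] G' := hx
    simp only [christoffel, christoffelFirst, hx.fderiv_eq, hx.eq_of_nhds]
  ext u w
  have : curvature G z u w = curvature G' z u w := by
    ext v
    simp [curvature, hc.fderiv_eq, hc.eq_of_nhds]
  rw [ricciCoord, this, ricciCoord]

variable [FiniteDimensional ℝ E]

theorem isInvertible_of_nondegenerate {L : E →L[ℝ] E →L[ℝ] ℝ}
    (hL : ∀ v, (∀ w, L v w = 0) → v = 0) : L.IsInvertible := by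
  have hinj : Function.Injective L := by
    rw [injective_iff_map_eq_zero]
    exact fun a ha ↦ hL a fun w ↦ by rw [ha]; rfl
  have hdim : Module.finrank ℝ E = Module.finrank ℝ (E →L[ℝ] ℝ) := by
    rw [← (LinearMap.toContinuousLinearMap (𝕜 := ℝ) (E := E) (F' := ℝ)).finrank_eq]
    exact (Subspace.dual_finrank_eq (K := ℝ) (V := E)).symm
  refine ⟨(LinearEquiv.ofInjectiveOfFinrankEq (L : E →ₗ[ℝ] (E →L[ℝ] ℝ)) hinj
      hdim).toContinuousLinearEquiv, ?_⟩
  ext a b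
  rfl

theorem IsLocalMetric.metric_christoffel {G : E → E →L[ℝ] E →L[ℝ] ℝ} {z : E}
    (h : IsLocalMetric G z) (u v w : E) :
    G z (christoffel G z u v) w = christoffelFirst G z u v w :=
  TwistedProduct.metric_christoffel G z h.nondegenerate.self_of_nhds u v w

theorem IsLocalMetric.eq_christoffel {G : E → E →L[ℝ] E →L[ℝ] ℝ} {z : E}
    (h : IsLocalMetric G z) {u v x : E} (hx : ∀ w, G z x w = christoffelFirst G z u v w) :
    christoffel G z u v = x := by
  refine sub_eq_zero.1 (h.nondegenerate.self_of_nhds _ fun w ↦ ?_)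
  simp [h.metric_christoffel, hx]

theorem IsLocalMetric.differentiableAt_christoffel {G : E → E →L[ℝ] E →L[ℝ] ℝ} {z : E}
    (h : IsLocalMetric G z) : DifferentiableAt ℝ (christoffel G) z := by
  have hd : DifferentiableAt ℝ (fderiv ℝ G) z :=
    (h.contDiffAt.fderiv_right (m := 1) (by norm_num)).differentiableAt (by decide)
  have hflip : DifferentiableAt ℝ (fun x ↦ (fderiv ℝ G x).flip) z :=
    (ContinuousLinearMap.flipₗᵢ ℝ E E (E →L[ℝ] ℝ)).toContinuousLinearEquiv.differentiableAt.comp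
      z hd
  have hfirst : DifferentiableAt ℝ (christoffelFirst G) z := by
    unfold christoffelFirst
    exact ((hd.add hflip).sub (DifferentiableAt.clm_comp (differentiableAt_const _)
      hflip)).const_smul (1 / 2 : ℝ)
  have hinv : DifferentiableAt ℝ (fun x ↦ (G x).inverse) z :=
    ((isInvertible_of_nondegenerate
      h.nondegenerate.self_of_nhds).contDiffAt_map_inverse (n := 1)).differentiableAt
        (by decide) |>.comp z h.differentiableAt
  exact ((ContinuousLinearMap.compL ℝ E (E →L[ℝ] ℝ) E).differentiableAt.comp z
    hinv).clm_comp hfirst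

end LocalMetric

section Trace

variable {m : ℕ} {EB : Type*} [AddCommGroup EB] [Module ℝ EB] [FiniteDimensional ℝ EB]
  {E : Fin m → Type*} [∀ i, AddCommGroup (E i)] [∀ i, Module ℝ (E i)]
  [∀ i, FiniteDimensional ℝ (E i)]

/-- The trace of an endomorphism of `EB × ∀ i, E i` is the sum of those of its diagonal blocks. -/
theorem trace_prod_pi (T : (EB × ∀ i, E i) →ₗ[ℝ] (EB × ∀ i, E i)) :
    LinearMap.trace ℝ _ T =
      LinearMap.trace ℝ EB (LinearMap.fst ℝ _ _ ∘ₗ T ∘ₗ LinearMap.inl ℝ _ _) +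
        ∑ i, LinearMap.trace ℝ (E i) ((LinearMap.proj i ∘ₗ LinearMap.snd ℝ _ _) ∘ₗ T ∘ₗ
          (LinearMap.inr ℝ _ _ ∘ₗ LinearMap.single ℝ E i)) := by
  have hT : T = (T ∘ₗ LinearMap.inl ℝ _ _) ∘ₗ LinearMap.fst ℝ _ _ +
      ∑ i, (T ∘ₗ (LinearMap.inr ℝ _ _ ∘ₗ LinearMap.single ℝ E i)) ∘ₗ
        (LinearMap.proj i ∘ₗ LinearMap.snd ℝ _ _) := by
    refine LinearMap.ext fun v ↦ ?_
    simp only [LinearMap.add_apply, LinearMap.sum_apply, LinearMap.comp_apply, ← map_sum,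
      ← map_add]
    congr 1
    refine Prod.ext (by simp [Prod.fst_sum]) ?_
    simp [Finset.univ_sum_single]
  conv_lhs => rw [hT]
  rw [map_add, map_sum, LinearMap.trace_comp_comm']
  congr 1
  refine Finset.sum_congr rfl fun i _ ↦ ?_
  rw [LinearMap.trace_comp_comm']

end Trace

theorem contDiffAt_bilinearComp {F F' F'' : Type*} [NormedAddCommGroup F] [NormedSpace ℝ F]
    [NormedAddCommGroup F'] [NormedSpace ℝ F'] [NormedAddCommGroup F''] [NormedSpace ℝ F'']
    {n : WithTop ℕ∞} (L : F' →L[ℝ] F) {f : F'' → F →L[ℝ] F →L[ℝ] ℝ} {x : F''}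
    (hf : ContDiffAt ℝ n f x) : ContDiffAt ℝ n (fun y ↦ (f y).bilinearComp L L) x := by
  have h₁ : ContDiffAt ℝ n (fun y ↦ (f y ∘L L).flip) x :=
    (ContinuousLinearMap.flipₗᵢ ℝ F' F ℝ).contDiff.contDiffAt.comp x
      (hf.clm_comp contDiffAt_const)
  exact (ContinuousLinearMap.flipₗᵢ ℝ F' F' ℝ).contDiff.contDiffAt.comp x
    (h₁.clm_comp contDiffAt_const)

section TwistedCoordinates

variable {m : ℕ} {EB : Type*} [NormedAddCommGroup EB] [NormedSpace ℝ EB]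
  {E : Fin m → Type*} [∀ i, NormedAddCommGroup (E i)] [∀ i, NormedSpace ℝ (E i)]

/-- The metric `A ⊕ e^(2φ₁) K₁ ⊕ ⋯ ⊕ e^(2φₘ) Kₘ` on `EB × E₁ × ⋯ × Eₘ`. -/
def twistedForm (A : EB → EB →L[ℝ] EB →L[ℝ] ℝ) (K : ∀ i, E i → E i →L[ℝ] E i →L[ℝ] ℝ)
    (φ : ∀ i, EB × E i → ℝ) (z : EB × ∀ i, E i) :
    (EB × ∀ i, E i) →L[ℝ] (EB × ∀ i, E i) →L[ℝ] ℝ :=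
  sumForm (A z.1) (fun i ↦ K i (z.2 i)) (fun i ↦ Real.exp (2 * φ i (z.1, z.2 i)))

/-- The projection of `EB × E₁ × ⋯ × Eₘ` to `EB × Eᵢ`. -/
def projPair (EB : Type*) [NormedAddCommGroup EB] [NormedSpace ℝ EB]
    (E : Fin m → Type*) [∀ i, NormedAddCommGroup (E i)] [∀ i, NormedSpace ℝ (E i)] (i : Fin m) :
    (EB × ∀ i, E i) →L[ℝ] EB × E i :=
  (ContinuousLinearMap.fst ℝ EB (∀ i, E i)).prod
    (ContinuousLinearMap.proj i ∘L ContinuousLinearMap.snd ℝ EB (∀ i, E i))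

@[simp]
theorem projPair_apply (i : Fin m) (z : EB × ∀ i, E i) : projPair EB E i z = (z.1, z.2 i) := rfl

variable {A : EB → EB →L[ℝ] EB →L[ℝ] ℝ} {K : ∀ i, E i → E i →L[ℝ] E i →L[ℝ] ℝ}
  {φ : ∀ i, EB × E i → ℝ} {z : EB × ∀ i, E i}

theorem twistedForm_apply (u v : EB × ∀ i, E i) :
    twistedForm A K φ z u v =
      A z.1 u.1 v.1 + ∑ i, Real.exp (2 * φ i (z.1, z.2 i)) * K i (z.2 i) (u.2 i) (v.2 i) :=
  sumForm_apply _ _ _ _ _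

theorem twistedForm_apply_base (u : EB × ∀ i, E i) (Y : EB) :
    twistedForm A K φ z u (Y, 0) = A z.1 u.1 Y := by
  simp [twistedForm_apply]

theorem twistedForm_apply_single (u : EB × ∀ i, E i) (i : Fin m) (V : E i) :
    twistedForm A K φ z u (0, Pi.single i V) =
      Real.exp (2 * φ i (z.1, z.2 i)) * K i (z.2 i) (u.2 i) V := by
  rw [twistedForm_apply, Finset.sum_eq_single i]
  · simp
  · intro j _ hj
    simp [Pi.single_eq_of_ne hj]
  · simp

/-- The components of a multiply twisted product metric near a point. -/
structure IsTwistedData (A : EB → EB →L[ℝ] EB →L[ℝ] ℝ) (K : ∀ i, E i → E i →L[ℝ] E i →L[ℝ] ℝ)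
    (φ : ∀ i, EB × E i → ℝ) (z : EB × ∀ i, E i) : Prop where
  base : IsLocalMetric A z.1
  fiber (i : Fin m) : IsLocalMetric (K i) (z.2 i)
  twist (i : Fin m) : ContDiffAt ℝ 2 (φ i) (z.1, z.2 i)

namespace IsTwistedData

theorem eventually (h : IsTwistedData A K φ z) : ∀ᶠ x in 𝓝 z, IsTwistedData A K φ x := by
  have h₁ : ∀ᶠ x in 𝓝 z, IsLocalMetric A x.1 :=
    continuous_fst.continuousAt.eventually h.base.eventually
  have h₂ : ∀ᶠ x in 𝓝 z, ∀ i, IsLocalMetric (K i) (x.2 i) :=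
    eventually_all.2 fun i ↦ ((continuous_apply i).comp continuous_snd).continuousAt.eventually
      (h.fiber i).eventually
  have h₃ : ∀ᶠ x in 𝓝 z, ∀ i, ContDiffAt ℝ 2 (φ i) (projPair EB E i x) :=
    eventually_all.2 fun i ↦ (projPair EB E i).continuous.continuousAt.eventually
      ((h.twist i).eventually (by decide))
  filter_upwards [h₁, h₂, h₃] with x h₁ h₂ h₃ using ⟨h₁, h₂, h₃⟩

theorem contDiffAt (h : IsTwistedData A K φ z) : ContDiffAt ℝ 2 (twistedForm A K φ) z := by
  have hA : ContDiffAt ℝ 2 (fun x : EB × ∀ i, E i ↦ A x.1) z :=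
    h.base.contDiffAt.comp z contDiffAt_fst
  have hK (i) : ContDiffAt ℝ 2 (fun x : EB × ∀ i, E i ↦ K i (x.2 i)) z :=
    (h.fiber i).contDiffAt.comp z
      (ContinuousLinearMap.proj i ∘L ContinuousLinearMap.snd ℝ EB (∀ i, E i)).contDiff.contDiffAt
  have hφ (i) : ContDiffAt ℝ 2 (fun x : EB × ∀ i, E i ↦ φ i (x.1, x.2 i)) z :=
    ContDiffAt.comp z (h.twist i) (projPair EB E i).contDiff.contDiffAt
  unfold twistedForm sumForm
  refine (contDiffAt_bilinearComp _ hA).add (ContDiffAt.sum fun i _ ↦ ?_)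
  exact (contDiffAt_const.mul (hφ i)).exp.smul
    (contDiffAt_bilinearComp _ (hK i))

theorem isLocalMetric (h : IsTwistedData A K φ z) : IsLocalMetric (twistedForm A K φ) z where
  contDiffAt := h.contDiffAt
  symm := by
    filter_upwards [h.eventually] with x hx v w
    simp only [twistedForm_apply, hx.base.symm.self_of_nhds v.1 w.1]
    congr 1
    exact Finset.sum_congr rfl fun i _ ↦ by rw [(hx.fiber i).symm.self_of_nhds (v.2 i)]
  nondegenerate := by
    filter_upwards [h.eventually] with x hx v hv
    refine Prod.ext (hx.base.nondegenerate.self_of_nhds _ fun Y ↦ ?_) (funext fun i ↦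
      (hx.fiber i).nondegenerate.self_of_nhds _ fun V ↦ ?_)
    · rw [← hv (Y, 0), twistedForm_apply_base]
    · have := hv (0, Pi.single i V)
      rw [twistedForm_apply_single] at this
      exact (mul_eq_zero.1 this).resolve_left (Real.exp_pos _).ne'

theorem fderiv_twistedForm (h : IsTwistedData A K φ z) (u v w : EB × ∀ i, E i) :
    fderiv ℝ (twistedForm A K φ) z u v w = fderiv ℝ A z.1 u.1 v.1 w.1 +
      ∑ i, Real.exp (2 * φ i (z.1, z.2 i)) *
        (2 * fderiv ℝ (φ i) (z.1, z.2 i) (u.1, u.2 i) * K i (z.2 i) (v.2 i) (w.2 i) +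
          fderiv ℝ (K i) (z.2 i) (u.2 i) (v.2 i) (w.2 i)) := by
  rw [fderiv_clm_apply₂ h.isLocalMetric.differentiableAt]
  simp only [twistedForm_apply]
  have hA : HasFDerivAt (fun x : EB × ∀ i, E i ↦ A x.1)
      (fderiv ℝ A z.1 ∘L ContinuousLinearMap.fst ℝ EB (∀ i, E i)) z :=
    h.base.differentiableAt.hasFDerivAt.comp z hasFDerivAt_fst
  have hK (i) : HasFDerivAt (fun x : EB × ∀ i, E i ↦ K i (x.2 i))
      (fderiv ℝ (K i) (z.2 i) ∘L
        (ContinuousLinearMap.proj i ∘L ContinuousLinearMap.snd ℝ EB (∀ i, E i))) z :=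
    HasFDerivAt.comp z (h.fiber i).differentiableAt.hasFDerivAt
      (ContinuousLinearMap.proj i ∘L ContinuousLinearMap.snd ℝ EB (∀ i, E i)).hasFDerivAt
  have hφ (i) : HasFDerivAt (fun x : EB × ∀ i, E i ↦ φ i (x.1, x.2 i))
      (fderiv ℝ (φ i) (z.1, z.2 i) ∘L projPair EB E i) z :=
    HasFDerivAt.comp z ((h.twist i).differentiableAt (by decide)).hasFDerivAt
      (projPair EB E i).hasFDerivAt
  have key := ((hA.clm_apply (hasFDerivAt_const v.1 z)).clm_apply (hasFDerivAt_const w.1 z)).fun_add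
    (HasFDerivAt.fun_sum (u := Finset.univ) fun i _ ↦ (((hφ i).const_mul 2).exp.fun_mul
      (((hK i).clm_apply (hasFDerivAt_const (v.2 i) z)).clm_apply (hasFDerivAt_const (w.2 i) z))))
  rw [key.fderiv]
  simp only [add_apply, sum_apply]
  congr 1
  · simp
  · refine Finset.sum_congr rfl fun i _ ↦ ?_
    simp
    ring

end IsTwistedData
end TwistedCoordinates

section TwistedRicci

variable {m : ℕ} {EB : Type*} [NormedAddCommGroup EB] [NormedSpace ℝ EB]
  {E : Fin m → Type*} [∀ i, NormedAddCommGroup (E i)] [∀ i, NormedSpace ℝ (E i)]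
  {A : EB → EB →L[ℝ] EB →L[ℝ] ℝ} {K : ∀ i, E i → E i →L[ℝ] E i →L[ℝ] ℝ}
  {φ : ∀ i, EB × E i → ℝ} {z : EB × ∀ i, E i}

namespace IsTwistedData

theorem fderiv_twistedForm_single (h : IsTwistedData A K φ z) (u : EB × ∀ i, E i) (i : Fin m)
    (v w : E i) :
    fderiv ℝ (twistedForm A K φ) z u (0, Pi.single i v) (0, Pi.single i w) =
      Real.exp (2 * φ i (z.1, z.2 i)) *
        (2 * fderiv ℝ (φ i) (z.1, z.2 i) (u.1, u.2 i) * K i (z.2 i) v w +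
          fderiv ℝ (K i) (z.2 i) (u.2 i) v w) := by
  rw [h.fderiv_twistedForm, Finset.sum_eq_single i]
  · simp
  · intro j _ hj
    simp [Pi.single_eq_of_ne hj]
  · simp

theorem fderiv_twistedForm_single_of_ne (h : IsTwistedData A K φ z) (u : EB × ∀ i, E i)
    {i j : Fin m} (hij : i ≠ j) (v : E i) (w : E j) :
    fderiv ℝ (twistedForm A K φ) z u (0, Pi.single i v) (0, Pi.single j w) = 0 := by
  rw [h.fderiv_twistedForm, Finset.sum_eq_zero]
  · simp
  · intro k _
    by_cases hk : k = i
    · subst hk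
      simp [Pi.single_eq_of_ne hij]
    · simp [Pi.single_eq_of_ne hk]

variable [FiniteDimensional ℝ EB] [∀ i, FiniteDimensional ℝ (E i)]

theorem christoffel_base_left (h : IsTwistedData A K φ z) (X : EB) (w : EB × ∀ i, E i) :
    christoffel (twistedForm A K φ) z (X, 0) w =
      (christoffel A z.1 X w.1, fun i ↦ fderiv ℝ (φ i) (z.1, z.2 i) (X, 0) • w.2 i) := by
  refine h.isLocalMetric.eq_christoffel fun w' ↦ ?_
  rw [christoffelFirst_apply, h.fderiv_twistedForm, h.fderiv_twistedForm, h.fderiv_twistedForm,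
    twistedForm_apply, h.base.metric_christoffel, christoffelFirst_apply]
  have hs : ∑ i, Real.exp (2 * φ i (z.1, z.2 i)) *
      K i (z.2 i) (fderiv ℝ (φ i) (z.1, z.2 i) (X, 0) • w.2 i) (w'.2 i) =
      1 / 2 * ∑ i, Real.exp (2 * φ i (z.1, z.2 i)) *
        (2 * fderiv ℝ (φ i) (z.1, z.2 i) (X, 0) * K i (z.2 i) (w.2 i) (w'.2 i)) := by
    rw [Finset.mul_sum]
    refine Finset.sum_congr rfl fun i _ ↦ ?_
    simp
    ring
  simp only [hs]
  simp
  ring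

theorem metric_christoffel_fiber (h : IsTwistedData A K φ z) (u v : EB × ∀ i, E i) (i : Fin m)
    (U : E i) :
    Real.exp (2 * φ i (z.1, z.2 i)) *
        K i (z.2 i) ((christoffel (twistedForm A K φ) z u v).2 i) U =
      christoffelFirst (twistedForm A K φ) z u v (0, Pi.single i U) := by
  rw [← twistedForm_apply_single, h.isLocalMetric.metric_christoffel]

theorem metric_christoffel_single_single (h : IsTwistedData A K φ z) (i : Fin m) (v V U : E i) :
    K i (z.2 i) ((christoffel (twistedForm A K φ) z (0, Pi.single i v) (0, Pi.single i V)).2 i) U =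
      fderiv ℝ (φ i) (z.1, z.2 i) (0, v) * K i (z.2 i) V U +
        fderiv ℝ (φ i) (z.1, z.2 i) (0, V) * K i (z.2 i) v U -
        fderiv ℝ (φ i) (z.1, z.2 i) (0, U) * K i (z.2 i) v V +
        christoffelFirst (K i) (z.2 i) v V U := by
  refine mul_left_cancel₀ (Real.exp_pos (2 * φ i (z.1, z.2 i))).ne' ?_
  rw [h.metric_christoffel_fiber, christoffelFirst_apply, christoffelFirst_apply,
    h.fderiv_twistedForm_single, h.fderiv_twistedForm_single, h.fderiv_twistedForm_single]
  simp
  ring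

theorem christoffel_single_single_of_ne (h : IsTwistedData A K φ z) {i j : Fin m} (hij : i ≠ j)
    (v : E j) (V : E i) :
    (christoffel (twistedForm A K φ) z (0, Pi.single j v) (0, Pi.single i V)).2 j = 0 := by
  refine (h.fiber j).nondegenerate.self_of_nhds _ fun U ↦ ?_
  refine (mul_eq_zero.1 ?_).resolve_left (Real.exp_pos (2 * φ j (z.1, z.2 j))).ne'
  rw [h.metric_christoffel_fiber, christoffelFirst_apply, h.fderiv_twistedForm_single_of_ne _ hij,
    h.fderiv_twistedForm_single, h.fderiv_twistedForm_single_of_ne _ hij.symm]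
  simp [Pi.single_eq_of_ne hij.symm, ← Prod.zero_eq_mk]

/-- Components of the derivative of the Christoffel symbols. -/
theorem clm_fderiv_christoffel {F : Type*} [NormedAddCommGroup F] [NormedSpace ℝ F]
    (h : IsTwistedData A K φ z) (L : (EB × ∀ i, E i) →L[ℝ] F) (u v w : EB × ∀ i, E i) :
    L (fderiv ℝ (christoffel (twistedForm A K φ)) z u v w) =
      fderiv ℝ (fun x ↦ L (christoffel (twistedForm A K φ) x v w)) z u := by
  have hd := h.isLocalMetric.differentiableAt_christoffel
  have h₁ := L.hasFDerivAt.comp z ((hd.hasFDerivAt.clm_apply (hasFDerivAt_const v z)).clm_apply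
    (hasFDerivAt_const w z))
  have h₂ : fderiv ℝ (fun x ↦ L (christoffel (twistedForm A K φ) x v w)) z = _ := h₁.fderiv
  rw [h₂]
  simp

theorem curvature_base_fst (h : IsTwistedData A K φ z) (X Y : EB) (i : Fin m) (V : E i) :
    (curvature (twistedForm A K φ) z (X, 0) (0, Pi.single i V) (Y, 0)).1 = 0 := by
  have hz (X Y : EB) : (fderiv ℝ (christoffel (twistedForm A K φ)) z (X, 0) (Y, 0)
      (0, Pi.single i V)).1 = 0 := by
    refine (h.clm_fderiv_christoffel (ContinuousLinearMap.fst ℝ EB (∀ i, E i)) _ _ _).trans ?_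
    have : (fun x ↦ ContinuousLinearMap.fst ℝ EB (∀ i, E i) (christoffel (twistedForm A K φ) x
        (Y, 0) (0, Pi.single i V))) =ᶠ[𝓝 z] fun _ ↦ 0 := by
      filter_upwards [h.eventually] with x hx
      simp [hx.christoffel_base_left]
    rw [this.fderiv_eq]
    simp
  simp [curvature, hz, h.christoffel_base_left]

theorem curvature_single_of_ne (h : IsTwistedData A K φ z) (X : EB) {i j : Fin m} (hij : i ≠ j)
    (v : E j) (V : E i) :
    (curvature (twistedForm A K φ) z (X, 0) (0, Pi.single i V) (0, Pi.single j v)).2 j = 0 := by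
  let L := ContinuousLinearMap.proj (R := ℝ) (φ := E) j ∘L ContinuousLinearMap.snd ℝ EB (∀ i, E i)
  have h₁ : (fderiv ℝ (christoffel (twistedForm A K φ)) z (X, 0) (0, Pi.single j v)
      (0, Pi.single i V)).2 j = 0 := by
    refine (h.clm_fderiv_christoffel L _ _ _).trans ?_
    have : (fun x ↦ L (christoffel (twistedForm A K φ) x (0, Pi.single j v)
        (0, Pi.single i V))) =ᶠ[𝓝 z] fun _ ↦ 0 := by
      filter_upwards [h.eventually] with x hx using hx.christoffel_single_single_of_ne hij v V
    rw [this.fderiv_eq]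
    simp
  have h₂ : (fderiv ℝ (christoffel (twistedForm A K φ)) z (0, Pi.single j v) (X, 0)
      (0, Pi.single i V)).2 j = 0 := by
    refine (h.clm_fderiv_christoffel L _ _ _).trans ?_
    have : (fun x ↦ L (christoffel (twistedForm A K φ) x (X, 0)
        (0, Pi.single i V))) =ᶠ[𝓝 z] fun _ ↦ 0 := by
      filter_upwards [h.eventually] with x hx
      simp [L, hx.christoffel_base_left, Pi.single_eq_of_ne hij.symm]
    rw [this.fderiv_eq]
    simp
  have h₃ : (fun k ↦ fderiv ℝ (φ k) (z.1, z.2 k) (X, 0) • (Pi.single i V : ∀ i, E i) k) =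
      Pi.single i (fderiv ℝ (φ i) (z.1, z.2 i) (X, 0) • V) := by
    funext k
    by_cases hk : k = i
    · subst hk
      simp
    · simp [Pi.single_eq_of_ne hk]
  simp [curvature, h₁, h₂, h.christoffel_base_left, h₃, h.christoffel_single_single_of_ne hij]

/-- The curvature block of a fiber in a mixed direction. -/
theorem metric_curvature_single (h : IsTwistedData A K φ z) (X : EB) (i : Fin m) (v V U : E i) :
    K i (z.2 i)
        ((curvature (twistedForm A K φ) z (X, 0) (0, Pi.single i V) (0, Pi.single i v)).2 i) U =
      fderiv ℝ (fderiv ℝ (φ i)) (z.1, z.2 i) (X, 0) (0, V) * K i (z.2 i) v U -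
        fderiv ℝ (fderiv ℝ (φ i)) (z.1, z.2 i) (X, 0) (0, U) * K i (z.2 i) v V := by
  let L := ContinuousLinearMap.proj (R := ℝ) (φ := E) i ∘L ContinuousLinearMap.snd ℝ EB (∀ i, E i)
  have hdφ : DifferentiableAt ℝ (fderiv ℝ (φ i)) (z.1, z.2 i) :=
    ((h.twist i).fderiv_right (m := 1) (by norm_num)).differentiableAt (by decide)
  have hφ (q : EB × E i) : HasFDerivAt
      (fun x : EB × ∀ i, E i ↦ fderiv ℝ (φ i) (x.1, x.2 i) q)
      (((fderiv ℝ (fderiv ℝ (φ i)) (z.1, z.2 i)).flip q) ∘L projPair EB E i) z := by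
    have := (HasFDerivAt.comp z (g := fderiv ℝ (φ i)) (f := projPair EB E i) hdφ.hasFDerivAt
      (projPair EB E i).hasFDerivAt).clm_apply (hasFDerivAt_const q z)
    refine this.congr_fderiv ?_
    ext <;> simp
  have hsymm (v : E i) : fderiv ℝ (fderiv ℝ (φ i)) (z.1, z.2 i) (0, v) (X, 0) =
      fderiv ℝ (fderiv ℝ (φ i)) (z.1, z.2 i) (X, 0) (0, v) :=
    (h.twist i).isSymmSndFDerivAt (by simp) _ _
  have h₁ : K i (z.2 i) ((fderiv ℝ (christoffel (twistedForm A K φ)) z (X, 0) (0, Pi.single i v)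
      (0, Pi.single i V)).2 i) U =
      fderiv ℝ (fderiv ℝ (φ i)) (z.1, z.2 i) (X, 0) (0, v) * K i (z.2 i) V U +
        fderiv ℝ (fderiv ℝ (φ i)) (z.1, z.2 i) (X, 0) (0, V) * K i (z.2 i) v U -
        fderiv ℝ (fderiv ℝ (φ i)) (z.1, z.2 i) (X, 0) (0, U) * K i (z.2 i) v V := by
    have hC := HasFDerivAt.comp z.1 (g := fun x ↦ christoffel (twistedForm A K φ) x
        (0, Pi.single i v) (0, Pi.single i V)) (f := fun s ↦ (s, z.2))
      ((h.isLocalMetric.differentiableAt_christoffel.hasFDerivAt.clm_apply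
        (hasFDerivAt_const (0, Pi.single i v) z)).clm_apply
        (hasFDerivAt_const (0, Pi.single i V) z)) (hasFDerivAt_prodMk_left z.1 z.2)
    have hF := ((K i (z.2 i)).flip U ∘L L).hasFDerivAt.comp z.1 hC
    have hψ (q : EB × E i) := HasFDerivAt.comp z.1 (f := fun s ↦ (s, z.2)) (hφ q)
      (hasFDerivAt_prodMk_left z.1 z.2)
    have hF' := ((((hψ (0, v)).mul_const (K i (z.2 i) V U)).add
      ((hψ (0, V)).mul_const (K i (z.2 i) v U))).sub
      ((hψ (0, U)).mul_const (K i (z.2 i) v V))).add_const (christoffelFirst (K i) (z.2 i) v V U)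
    have hev : ∀ᶠ s in 𝓝 z.1, IsTwistedData A K φ (s, z.2) :=
      (continuous_id.prodMk continuous_const).continuousAt.eventually h.eventually
    have := DFunLike.congr_fun (hF.unique (hF'.congr_of_eventuallyEq (by
      filter_upwards [hev] with s hs
        using hs.metric_christoffel_single_single i v V U))) X
    simpa [L, mul_comm] using this
  have h₂ : (fderiv ℝ (christoffel (twistedForm A K φ)) z (0, Pi.single i v) (X, 0)
      (0, Pi.single i V)).2 i =
        fderiv ℝ (fderiv ℝ (φ i)) (z.1, z.2 i) (X, 0) (0, v) • V := by
    refine (h.clm_fderiv_christoffel L _ _ _).trans ?_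
    have : (fun x ↦ L (christoffel (twistedForm A K φ) x (X, 0)
        (0, Pi.single i V))) =ᶠ[𝓝 z] fun x ↦ fderiv ℝ (φ i) (x.1, x.2 i) (X, 0) • V := by
      filter_upwards [h.eventually] with x hx
      simp [L, hx.christoffel_base_left]
    rw [this.fderiv_eq, ((hφ (X, 0)).smul_const V).fderiv]
    simp [hsymm]
  have h₃ : (fun k ↦ fderiv ℝ (φ k) (z.1, z.2 k) (X, 0) • (Pi.single i V : ∀ i, E i) k) =
      Pi.single i (fderiv ℝ (φ i) (z.1, z.2 i) (X, 0) • V) := by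
    funext k
    by_cases hk : k = i
    · subst hk
      simp
    · simp [Pi.single_eq_of_ne hk]
  have h₄ (c : ℝ) : christoffel (twistedForm A K φ) z (0, Pi.single i v) (0, c • Pi.single i V) =
      c • christoffel (twistedForm A K φ) z (0, Pi.single i v) (0, Pi.single i V) := by
    rw [← map_smul, Prod.smul_mk, smul_zero]
  simp [curvature, h₁, h₂, h.christoffel_base_left, h₃, Pi.single_smul, h₄]
  ring

/-- The mixed Ricci curvature of a multiply twisted product in coordinates. -/
theorem ricciCoord_mixed (h : IsTwistedData A K φ z) (X : EB) (i : Fin m) (V : E i) :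
    ricciCoord (twistedForm A K φ) z (X, 0) (0, Pi.single i V) =
      (Module.finrank ℝ (E i) - 1) * fderiv ℝ (fderiv ℝ (φ i)) (z.1, z.2 i) (X, 0) (0, V) := by
  rw [ricciCoord, trace_prod_pi, Finset.sum_eq_single i]
  rotate_left
  · intro j _ hj
    refine (congrArg _ (LinearMap.ext fun v ↦ ?_)).trans (map_zero _)
    simpa using h.curvature_single_of_ne X hj.symm v V
  · simp
  have h₀ : LinearMap.fst ℝ EB (∀ i, E i) ∘ₗ curvature (twistedForm A K φ) z (X, 0)
      (0, Pi.single i V) ∘ₗ LinearMap.inl ℝ EB (∀ i, E i) = 0 := by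
    ext Y
    simpa using h.curvature_base_fst X Y i V
  obtain ⟨e, he⟩ := isInvertible_of_nondegenerate (h.fiber i).nondegenerate.self_of_nhds
  obtain ⟨H, hH⟩ : ∃ H : E i →L[ℝ] ℝ, ∀ U, fderiv ℝ (fderiv ℝ (φ i)) (z.1, z.2 i) (X, 0) (0, U) =
      H U :=
    ⟨fderiv ℝ (fderiv ℝ (φ i)) (z.1, z.2 i) (X, 0) ∘L ContinuousLinearMap.inr ℝ EB (E i),
      fun U ↦ by simp⟩
  have hHe (U : E i) : K i (z.2 i) (e.symm H) U = H U := by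
    rw [← he]
    simp
  have h₁ : (LinearMap.proj i ∘ₗ LinearMap.snd ℝ EB (∀ i, E i)) ∘ₗ
      curvature (twistedForm A K φ) z (X, 0) (0, Pi.single i V) ∘ₗ
        (LinearMap.inr ℝ EB (∀ i, E i) ∘ₗ LinearMap.single ℝ E i) =
      H V • LinearMap.id - ((K i (z.2 i)).flip V : E i →ₗ[ℝ] ℝ).smulRight (e.symm H) := by
    ext v
    refine sub_eq_zero.1 ((h.fiber i).nondegenerate.self_of_nhds _ fun U ↦ ?_)
    have := h.metric_curvature_single X i v V U
    simp [this, hHe, hH]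
    ring
  rw [h₀, h₁, map_sub, LinearMap.trace_smulRight]
  simp only [map_zero, map_smul, LinearMap.trace_id, zero_add]
  have : K i (z.2 i) (e.symm H) V = H V := hHe V
  simp [this, hH]
  ring

end IsTwistedData
end TwistedRicci

theorem contDiffAt_clm_apply {D E F : Type*} [NormedAddCommGroup D] [NormedSpace ℝ D]
    [NormedAddCommGroup E] [NormedSpace ℝ E] [FiniteDimensional ℝ E]
    [NormedAddCommGroup F] [NormedSpace ℝ F] {f : D → E →L[ℝ] F} {x : D} {n : WithTop ℕ∞}
    (h : ∀ v, ContDiffAt ℝ n (fun y ↦ f y v) x) : ContDiffAt ℝ n f x := by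
  have hd : Module.finrank ℝ E = Module.finrank ℝ (Fin (Module.finrank ℝ E) → ℝ) :=
    Module.finrank_fin_fun ℝ |>.symm
  let e₁ := ContinuousLinearEquiv.ofFinrankEq hd
  let e₂ := (e₁.arrowCongr (1 : F ≃L[ℝ] F)).trans (ContinuousLinearEquiv.piRing (Fin _))
  rw [← Function.id_comp f, ← e₂.symm_comp_self]
  exact e₂.symm.contDiff.contDiffAt.comp x (contDiffAt_pi.2 fun i ↦ h _)

section ChartComponents

variable {E : Type*} [NormedAddCommGroup E] [NormedSpace ℝ E]
  {M : Type*} [TopologicalSpace M] [ChartedSpace E M] [IsManifold 𝓘(ℝ, E) ∞ M]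

theorem chartFrame_bijective (p : M) {z : E} (hz : z ∈ (extChartAt 𝓘(ℝ, E) p).target) :
    Function.Bijective (chartFrame 𝓘(ℝ, E) p z) := by
  have : IsManifold 𝓘(ℝ, E) 1 M := .of_le (n := ∞) (by simp)
  rw [chartFrame_eq_tangentCoordChange _ _ hz]
  have h₁ := (extChartAt 𝓘(ℝ, E) p).map_target hz
  have h₂ := mem_extChartAt_source (I := 𝓘(ℝ, E)) ((extChartAt 𝓘(ℝ, E) p).symm z)
  have hl : Function.LeftInverse
      (tangentCoordChange 𝓘(ℝ, E) ((extChartAt 𝓘(ℝ, E) p).symm z) p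
        ((extChartAt 𝓘(ℝ, E) p).symm z))
      (tangentCoordChange 𝓘(ℝ, E) p ((extChartAt 𝓘(ℝ, E) p).symm z)
        ((extChartAt 𝓘(ℝ, E) p).symm z)) := fun v ↦ by
    rw [tangentCoordChange_comp ⟨⟨h₁, h₂⟩, h₁⟩, tangentCoordChange_self h₁]
  have hr : Function.RightInverse
      (tangentCoordChange 𝓘(ℝ, E) ((extChartAt 𝓘(ℝ, E) p).symm z) p
        ((extChartAt 𝓘(ℝ, E) p).symm z))
      (tangentCoordChange 𝓘(ℝ, E) p ((extChartAt 𝓘(ℝ, E) p).symm z)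
        ((extChartAt 𝓘(ℝ, E) p).symm z)) := fun v ↦ by
    rw [tangentCoordChange_comp ⟨⟨h₂, h₁⟩, h₂⟩, tangentCoordChange_self h₂]
  exact ⟨hl.injective, hr.surjective⟩

theorem hasFDerivAt_chartFrame (p : M) {z : E} (hz : z ∈ (extChartAt 𝓘(ℝ, E) p).target) :
    HasFDerivAt (extChartAt 𝓘(ℝ, E) ((extChartAt 𝓘(ℝ, E) p).symm z) ∘
      (extChartAt 𝓘(ℝ, E) p).symm) (chartFrame 𝓘(ℝ, E) p z : E →L[ℝ] E) z := by
  have : IsManifold 𝓘(ℝ, E) 1 M := .of_le (n := ∞) (by simp)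
  rw [chartFrame_eq_tangentCoordChange _ _ hz]
  have := hasFDerivWithinAt_tangentCoordChange (I := 𝓘(ℝ, E))
    ⟨(extChartAt 𝓘(ℝ, E) p).map_target hz,
      mem_extChartAt_source (I := 𝓘(ℝ, E)) ((extChartAt 𝓘(ℝ, E) p).symm z)⟩
  rwa [(extChartAt 𝓘(ℝ, E) p).right_inv hz, ModelWithCorners.range_eq_univ,
    hasFDerivWithinAt_univ] at this

theorem contMDiffAt_extChartAt_symm (p : M) :
    ContMDiffAt 𝓘(ℝ, E) 𝓘(ℝ, E) ∞ (extChartAt 𝓘(ℝ, E) p).symm (extChartAt 𝓘(ℝ, E) p p) :=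
  (contMDiffOn_extChartAt_symm p).contMDiffAt (extChartAt_target_mem_nhds p)

omit [IsManifold 𝓘(ℝ, E) ∞ M] in
theorem chartComponents_apply (g : BilinField 𝓘(ℝ, E) M) (p : M) (z v w : E) :
    chartComponents g p z v w = g ((extChartAt 𝓘(ℝ, E) p).symm z)
      (chartFrame 𝓘(ℝ, E) p z v) (chartFrame 𝓘(ℝ, E) p z w) := rfl

/-- The vector fields that are constant in the chart at `p` are smooth at `p`. -/
theorem contMDiffAt_symmL_trivializationAt (p : M) (v : E) :
    ContMDiffAt 𝓘(ℝ, E) (𝓘(ℝ, E).prod 𝓘(ℝ, E)) ∞ (fun q ↦ Bundle.TotalSpace.mk' E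
      (E := fun x : M ↦ TangentSpace 𝓘(ℝ, E) x) q
      ((trivializationAt E (TangentSpace 𝓘(ℝ, E)) p).symmL ℝ q v)) p := by
  have : IsManifold 𝓘(ℝ, E) 1 M := .of_le (n := ∞) (by simp)
  let e := trivializationAt E (TangentSpace 𝓘(ℝ, E) (M := M)) p
  have h : ContMDiffOn 𝓘(ℝ, E) (𝓘(ℝ, E).prod 𝓘(ℝ, E)) ∞ (fun q ↦ Bundle.TotalSpace.mk' E
      (E := fun x : M ↦ TangentSpace 𝓘(ℝ, E) x) q
      ((trivializationAt E (TangentSpace 𝓘(ℝ, E)) p).symmL ℝ q v)) e.baseSet := by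
    rw [Bundle.Trivialization.contMDiffOn_section_baseSet_iff]
    refine (contMDiffOn_const (c := v)).congr fun y hy ↦ ?_
    have := (trivializationAt E (TangentSpace 𝓘(ℝ, E) (M := M)) p).continuousLinearMapAt_symmL
      (R := ℝ) hy v
    rwa [Bundle.Trivialization.continuousLinearMapAt_apply,
      Bundle.Trivialization.linearMapAt_apply, if_pos hy] at this
  exact h.contMDiffAt (e.open_baseSet.mem_nhds (mem_baseSet_trivializationAt _ _ _))

theorem contDiffAt_chartComponents_apply (g : PseudoRiemannianMetric 𝓘(ℝ, E) M) (p : M)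
    (v w : E) : ContDiffAt ℝ ∞ (fun z ↦ chartComponents g.val p z v w)
      (extChartAt 𝓘(ℝ, E) p p) := by
  have : IsManifold 𝓘(ℝ, E) 1 M := .of_le (n := ∞) (by simp)
  let e := trivializationAt E (TangentSpace 𝓘(ℝ, E) (M := M)) p
  have h := ContMDiffAt.clm_bundle_apply₂ (b := id) (E₃ := Bundle.Trivial M ℝ) (F₃ := ℝ)
    g.contMDiff.contMDiffAt (contMDiffAt_symmL_trivializationAt p v)
    (contMDiffAt_symmL_trivializationAt p w)
  have h' : ContMDiffAt 𝓘(ℝ, E) 𝓘(ℝ, ℝ) ∞ (fun q ↦ g.val q (e.symmL ℝ q v) (e.symmL ℝ q w)) p :=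
    (Bundle.contMDiffAt_section (E := Bundle.Trivial M ℝ) p).1 h
  have h'' := ContMDiffAt.comp_of_eq h' (contMDiffAt_extChartAt_symm p) (extChartAt_to_inv p)
  refine (contMDiffAt_iff_contDiffAt.1 h'').congr_of_eventuallyEq ?_
  filter_upwards [extChartAt_target_mem_nhds (I := 𝓘(ℝ, E)) p] with z hz
  have hq := (extChartAt 𝓘(ℝ, E) p).map_target hz
  rw [extChartAt_source] at hq
  have hf : e.symmL ℝ ((extChartAt 𝓘(ℝ, E) p).symm z) = chartFrame 𝓘(ℝ, E) p z := by
    rw [chartFrame_eq_tangentCoordChange _ _ hz]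
    exact TangentBundle.symmL_trivializationAt_eq_core hq
  rw [chartComponents_apply, ← hf]
  rfl

theorem isLocalMetric_chartComponents [FiniteDimensional ℝ E]
    (g : PseudoRiemannianMetric 𝓘(ℝ, E) M) (p : M) :
    IsLocalMetric (chartComponents g.val p) (extChartAt 𝓘(ℝ, E) p p) where
  contDiffAt := contDiffAt_clm_apply fun v ↦ contDiffAt_clm_apply fun w ↦
    (contDiffAt_chartComponents_apply g p v w).of_le (by norm_cast)
  symm := Eventually.of_forall fun z v w ↦ by
    rw [chartComponents_apply, chartComponents_apply, g.symm]
  nondegenerate := by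
    filter_upwards [extChartAt_target_mem_nhds (I := 𝓘(ℝ, E)) p] with z hz v hv
    refine (injective_iff_map_eq_zero _).1 (chartFrame_bijective p hz).1 v
      (g.nondegenerate _ _ fun w ↦ ?_)
    obtain ⟨w, rfl⟩ := (chartFrame_bijective p hz).2 w
    rw [← chartComponents_apply, hv]

end ChartComponents

theorem fderiv_prod_pi_apply {m : ℕ} {EB : Type*} [NormedAddCommGroup EB] [NormedSpace ℝ EB]
    {E : Fin m → Type*} [∀ i, NormedAddCommGroup (E i)] [∀ i, NormedSpace ℝ (E i)]
    {z : EB × ∀ i, E i} {f : EB → EB} {L : EB →L[ℝ] EB} (hf : HasFDerivAt f L z.1)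
    {h : ∀ i, E i → E i} {L' : ∀ i, E i →L[ℝ] E i} (hh : ∀ i, HasFDerivAt (h i) (L' i) (z.2 i))
    (u : EB × ∀ i, E i) :
    fderiv ℝ (fun x : EB × ∀ i, E i ↦ ((f x.1, fun i ↦ h i (x.2 i)) : EB × ∀ i, E i)) z u =
      (L u.1, fun i ↦ L' i (u.2 i)) := by
  have hd := (hf.comp z hasFDerivAt_fst).prodMk (hasFDerivAt_pi.2 fun i ↦ HasFDerivAt.comp z (hh i)
    (ContinuousLinearMap.proj i ∘L ContinuousLinearMap.snd ℝ EB (∀ i, E i)).hasFDerivAt)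
  exact DFunLike.congr_fun hd.fderiv u

section ProductCharts

variable {m : ℕ}
  {EB : Type*} [NormedAddCommGroup EB] [NormedSpace ℝ EB]
  {B : Type*} [TopologicalSpace B] [ChartedSpace EB B]
  {E : Fin m → Type*} [∀ i, NormedAddCommGroup (E i)] [∀ i, NormedSpace ℝ (E i)]
  {F : Fin m → Type*} [∀ i, TopologicalSpace (F i)] [∀ i, ChartedSpace (E i) (F i)]

variable [IsManifold 𝓘(ℝ, EB) ∞ B] [∀ i, IsManifold 𝓘(ℝ, E i) ∞ (F i)]

theorem chartFrame_prodModel (p : B × ∀ i, F i) {z : EB × ∀ i, E i}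
    (hB : z.1 ∈ (extChartAt 𝓘(ℝ, EB) p.1).target)
    (hF : ∀ i, z.2 i ∈ (extChartAt 𝓘(ℝ, E i) (p.2 i)).target) (u : EB × ∀ i, E i) :
    (chartFrame (prodModel EB E) p z u : EB × ∀ i, E i) =
      (chartFrame 𝓘(ℝ, EB) p.1 z.1 u.1,
        fun i ↦ chartFrame 𝓘(ℝ, E i) (p.2 i) (z.2 i) (u.2 i)) := by
  have hB' : HasFDerivAt (extChartAt 𝓘(ℝ, EB) ((extChartAt 𝓘(ℝ, EB) p.1).symm z.1) ∘
      (extChartAt 𝓘(ℝ, EB) p.1).symm) (chartFrame 𝓘(ℝ, EB) p.1 z.1 : EB →L[ℝ] EB) z.1 :=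
    hasFDerivAt_chartFrame p.1 hB
  have hF' (i) : HasFDerivAt (extChartAt 𝓘(ℝ, E i) ((extChartAt 𝓘(ℝ, E i) (p.2 i)).symm (z.2 i)) ∘
      (extChartAt 𝓘(ℝ, E i) (p.2 i)).symm)
      (chartFrame 𝓘(ℝ, E i) (p.2 i) (z.2 i) : E i →L[ℝ] E i) (z.2 i) :=
    hasFDerivAt_chartFrame (p.2 i) (hF i)
  have hr : Set.range (prodModel EB E) = Set.univ := Set.range_eq_univ.2 fun x ↦ ⟨x, rfl⟩
  have hc : (chartFrame (prodModel EB E) p z u : EB × ∀ i, E i) =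
      fderivWithin ℝ (extChartAt (prodModel EB E) ((extChartAt (prodModel EB E) p).symm z) ∘
        (extChartAt (prodModel EB E) p).symm) (Set.range (prodModel EB E)) z u := rfl
  rw [hc, hr, fderivWithin_univ]
  exact fderiv_prod_pi_apply hB' hF' u

/-- The logarithm of a twisting function in the product of the charts at `x` and `y`. -/
def logInCharts {E' F' : Type*} [NormedAddCommGroup E'] [NormedSpace ℝ E'] [TopologicalSpace F']
    [ChartedSpace E' F'] (b : B × F' → ℝ) (x : B) (y : F') (q : EB × E') : ℝ :=
  Real.log (b ((extChartAt 𝓘(ℝ, EB) x).symm q.1, (extChartAt 𝓘(ℝ, E') y).symm q.2))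

theorem contDiffAt_logInCharts {E' F' : Type*} [NormedAddCommGroup E'] [NormedSpace ℝ E']
    [TopologicalSpace F'] [ChartedSpace E' F'] [IsManifold 𝓘(ℝ, E') ∞ F'] {b : B × F' → ℝ}
    (hpos : ∀ q, 0 < b q) (hb : ContMDiff ((𝓘(ℝ, EB)).prod 𝓘(ℝ, E')) 𝓘(ℝ, ℝ) ∞ b)
    (x : B) (y : F') :
    ContDiffAt ℝ ∞ (logInCharts (EB := EB) (E' := E') b x y)
      (extChartAt 𝓘(ℝ, EB) x x, extChartAt 𝓘(ℝ, E') y y) := by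
  have h := hb.contMDiffAt.comp
    (extChartAt 𝓘(ℝ, EB) x x, extChartAt 𝓘(ℝ, E') y y)
    (((contMDiffAt_extChartAt_symm x).prodMap (contMDiffAt_extChartAt_symm y)))
  rw [← modelWithCornersSelf_prod, chartedSpaceSelf_prod] at h
  exact h.contDiffAt.log (hpos _).ne'

theorem isTwistedData_chartComponents [FiniteDimensional ℝ EB] [∀ i, FiniteDimensional ℝ (E i)]
    (gB : PseudoRiemannianMetric 𝓘(ℝ, EB) B) (gF : ∀ i, PseudoRiemannianMetric 𝓘(ℝ, E i) (F i))
    {b : ∀ i, B × F i → ℝ} (hpos : ∀ i q, 0 < b i q)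
    (hb : ∀ i, ContMDiff ((𝓘(ℝ, EB)).prod 𝓘(ℝ, E i)) 𝓘(ℝ, ℝ) ∞ (b i)) (p : B × ∀ i, F i) :
    IsTwistedData (chartComponents gB.val p.1) (fun i ↦ chartComponents (gF i).val (p.2 i))
      (fun i ↦ logInCharts (b i) p.1 (p.2 i)) (extChartAt (prodModel EB E) p p) where
  base := isLocalMetric_chartComponents gB p.1
  fiber i := isLocalMetric_chartComponents (gF i) (p.2 i)
  twist i := (contDiffAt_logInCharts (hpos i) (hb i) p.1 (p.2 i)).of_le (by norm_cast)

theorem chartComponents_twistedMetric (gB : BilinField 𝓘(ℝ, EB) B)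
    (gF : ∀ i, BilinField 𝓘(ℝ, E i) (F i)) {b : ∀ i, B × F i → ℝ} (hpos : ∀ i q, 0 < b i q)
    (p : B × ∀ i, F i) :
    chartComponents (twistedMetric gB gF b) p =ᶠ[𝓝 (extChartAt (prodModel EB E) p p)]
      twistedForm (chartComponents gB p.1) (fun i ↦ chartComponents (gF i) (p.2 i))
        (fun i ↦ logInCharts (b i) p.1 (p.2 i)) := by
  have hB : ∀ᶠ z : EB × ∀ i, E i in 𝓝 (extChartAt (prodModel EB E) p p),
      z.1 ∈ (extChartAt 𝓘(ℝ, EB) p.1).target :=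
    continuous_fst.continuousAt.eventually (extChartAt_target_mem_nhds (I := 𝓘(ℝ, EB)) p.1 :
      (extChartAt 𝓘(ℝ, EB) p.1).target ∈ 𝓝 (extChartAt 𝓘(ℝ, EB) p.1 p.1))
  have hF : ∀ᶠ z : EB × ∀ i, E i in 𝓝 (extChartAt (prodModel EB E) p p),
      ∀ i, z.2 i ∈ (extChartAt 𝓘(ℝ, E i) (p.2 i)).target :=
    eventually_all.2 fun i ↦ ((continuous_apply i).comp continuous_snd).continuousAt.eventually
      (extChartAt_target_mem_nhds (I := 𝓘(ℝ, E i)) (p.2 i) :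
        (extChartAt 𝓘(ℝ, E i) (p.2 i)).target ∈
          𝓝 (extChartAt 𝓘(ℝ, E i) (p.2 i) (p.2 i)))
  filter_upwards [hB, hF] with z hB hF
  refine ContinuousLinearMap.ext fun u ↦ ContinuousLinearMap.ext fun v ↦ ?_
  rw [twistedForm_apply]
  have hc : chartComponents (twistedMetric gB gF b) p z u v =
      twistedMetric gB gF b ((extChartAt (prodModel EB E) p).symm z)
        (chartFrame (prodModel EB E) p z u : EB × ∀ i, E i)
        (chartFrame (prodModel EB E) p z v : EB × ∀ i, E i) := rfl
  rw [hc, chartFrame_prodModel p hB hF, chartFrame_prodModel p hB hF]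
  refine (sumForm_apply _ _ _ _ _).trans ?_
  congr 1
  refine Finset.sum_congr rfl fun i _ ↦ ?_
  congr 1
  rw [logInCharts, two_mul, Real.exp_add, Real.exp_log (hpos _ _), sq]
  rfl

/-- The mixed Ricci curvature of a multiply twisted product. -/
theorem ricci_twistedMetric_mixed [FiniteDimensional ℝ EB] [∀ i, FiniteDimensional ℝ (E i)]
    (gB : PseudoRiemannianMetric 𝓘(ℝ, EB) B) (gF : ∀ i, PseudoRiemannianMetric 𝓘(ℝ, E i) (F i))
    {b : ∀ i, B × F i → ℝ} (hpos : ∀ i q, 0 < b i q)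
    (hb : ∀ i, ContMDiff ((𝓘(ℝ, EB)).prod 𝓘(ℝ, E i)) 𝓘(ℝ, ℝ) ∞ (b i)) (p : B × ∀ i, F i)
    (X : EB) (i : Fin m) (V : E i) :
    ricci (twistedMetric gB.val (fun i ↦ (gF i).val) b) p ((X, 0) : EB × ∀ i, E i)
        ((0, Pi.single i V) : EB × ∀ i, E i) =
      (Module.finrank ℝ (E i) - 1) * fderiv ℝ (fderiv ℝ (logInCharts (b i) p.1 (p.2 i)))
        (extChartAt 𝓘(ℝ, EB) p.1 p.1, extChartAt 𝓘(ℝ, E i) (p.2 i) (p.2 i)) (X, 0) (0, V) := by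
  unfold ricci
  rw [ricciCoord_congr (chartComponents_twistedMetric gB.val (fun i ↦ (gF i).val) hpos p)]
  exact (isTwistedData_chartComponents gB gF hpos hb p).ricciCoord_mixed X i V

end ProductCharts

/-- A function on a connected manifold whose derivative vanishes, at each point in the chart at
that point, is constant. -/
theorem eq_of_hasFDerivAt_extChartAt_zero {E : Type*} [NormedAddCommGroup E] [NormedSpace ℝ E]
    {M : Type*} [TopologicalSpace M] [ChartedSpace E M] [IsManifold 𝓘(ℝ, E) ∞ M]
    [PreconnectedSpace M] {f : M → ℝ}
    (hf : ∀ p, HasFDerivAt (f ∘ (extChartAt 𝓘(ℝ, E) p).symm) (0 : E →L[ℝ] ℝ)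
      (extChartAt 𝓘(ℝ, E) p p)) (x y : M) : f x = f y := by
  have hloc (p : M) : ∀ᶠ q in 𝓝 p, f ((extChartAt 𝓘(ℝ, E) p).symm (extChartAt 𝓘(ℝ, E) p q)) =
      f q := by
    filter_upwards [extChartAt_source_mem_nhds (I := 𝓘(ℝ, E)) p] with q hq
    rw [(extChartAt 𝓘(ℝ, E) p).left_inv hq]
  have hcont (p : M) : ContinuousAt f p :=
    ((hf p).continuousAt.comp (continuousAt_extChartAt p)).congr (hloc p)
  have hm (p : M) : HasMFDerivAt 𝓘(ℝ, E) 𝓘(ℝ, ℝ) f p (0 : E →L[ℝ] ℝ) := 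
    ⟨hcont p, (hf p).hasFDerivWithinAt⟩
  have hc : IsLocallyConstant f := by
    rw [IsLocallyConstant.iff_eventually_eq]
    intro p
    obtain ⟨r, hr, hball⟩ := Metric.mem_nhds_iff.1 (extChartAt_target_mem_nhds (I := 𝓘(ℝ, E)) p)
    have hd : ∀ z ∈ Metric.ball (extChartAt 𝓘(ℝ, E) p p) r,
        HasFDerivAt (f ∘ (extChartAt 𝓘(ℝ, E) p).symm) (0 : E →L[ℝ] ℝ) z := fun z hz ↦ by
      have hs : MDifferentiableAt 𝓘(ℝ, E) 𝓘(ℝ, E) (extChartAt 𝓘(ℝ, E) p).symm z :=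
        ((contMDiffOn_extChartAt_symm (n := ∞) p).contMDiffAt
          (extChartAt_target_mem_nhds' (hball hz))).mdifferentiableAt (by simp)
      have := HasMFDerivAt.comp z (hm _) hs.hasMFDerivAt
      refine (hasMFDerivAt_iff_hasFDerivAt.1 this).congr_fderiv ?_
      exact ContinuousLinearMap.zero_comp _
    filter_upwards [hloc p, (continuousAt_extChartAt (I := 𝓘(ℝ, E)) p).eventually
      (Metric.ball_mem_nhds _ hr)] with q hq hqr
    rw [← hq, ← (hloc p).self_of_nhds]
    exact (convex_ball _ _).is_const_of_fderivWithin_eq_zero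
      (f := f ∘ (extChartAt 𝓘(ℝ, E) p).symm) (𝕜 := ℝ)
      (fun z hz ↦ (hd z hz).differentiableAt.differentiableWithinAt)
      (fun z hz ↦ (hd z hz).hasFDerivWithinAt.fderivWithin
        (Metric.isOpen_ball.uniqueDiffWithinAt hz)) hqr (Metric.mem_ball_self hr)
  exact hc.apply_eq_of_isPreconnected isPreconnected_univ (Set.mem_univ _) (Set.mem_univ _)

theorem fderiv_apply_zero_prod {E F G : Type*} [NormedAddCommGroup E] [NormedSpace ℝ E]
    [NormedAddCommGroup F] [NormedSpace ℝ F] [NormedAddCommGroup G] [NormedSpace ℝ G]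
    {φ : E × F → G} {x : E} {y : F} (h : DifferentiableAt ℝ φ (x, y)) (V : F) :
    fderiv ℝ φ (x, y) (0, V) = fderiv ℝ (fun t ↦ φ (x, t)) y V := by
  have := HasFDerivAt.comp y h.hasFDerivAt (hasFDerivAt_prodMk_right x y)
  have h₂ : fderiv ℝ (fun t ↦ φ (x, t)) y = _ := this.fderiv
  rw [h₂]
  simp

/-- The mixed second derivative as an iterated partial derivative. -/
theorem hasFDerivAt_fderiv_apply_zero_prod {E F G : Type*} [NormedAddCommGroup E]
    [NormedSpace ℝ E] [NormedAddCommGroup F] [NormedSpace ℝ F] [NormedAddCommGroup G]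
    [NormedSpace ℝ G] {φ : E × F → G} {x : E} {y : F} (h : ContDiffAt ℝ 2 φ (x, y)) (V : F) :
    HasFDerivAt (fun s ↦ fderiv ℝ (fun t ↦ φ (s, t)) y V)
      ((fderiv ℝ (fderiv ℝ φ) (x, y)).flip (0, V) ∘L ContinuousLinearMap.inl ℝ E F) x := by
  have hd : DifferentiableAt ℝ (fderiv ℝ φ) (x, y) :=
    (h.fderiv_right (m := 1) (by norm_num)).differentiableAt (by decide)
  have h₁ := HasFDerivAt.comp x (f := fun s ↦ (s, y))
    (hd.hasFDerivAt.clm_apply (hasFDerivAt_const (0, V) (x, y))) (hasFDerivAt_prodMk_left x y)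
  have hev : ∀ᶠ s in 𝓝 x, ContDiffAt ℝ 2 φ (s, y) :=
    (continuous_id.prodMk continuous_const).continuousAt.eventually (h.eventually (by decide))
  refine (h₁.congr_of_eventuallyEq ?_).congr_fderiv ?_
  · filter_upwards [hev] with s hs
    exact (fderiv_apply_zero_prod (hs.differentiableAt (by decide)) V).symm
  · ext X
    simp

section Splitting

variable {EB : Type*} [NormedAddCommGroup EB] [NormedSpace ℝ EB]
  {B : Type*} [TopologicalSpace B] [ChartedSpace EB B] [IsManifold 𝓘(ℝ, EB) ∞ B]
  {E : Type*} [NormedAddCommGroup E] [NormedSpace ℝ E]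
  {F : Type*} [TopologicalSpace F] [ChartedSpace E F] [IsManifold 𝓘(ℝ, E) ∞ F]

/-- A twisting function on a connected product whose logarithm has vanishing mixed second
derivatives is a product of functions on the factors. -/
theorem twist_split [PreconnectedSpace B] [PreconnectedSpace F] {b : B × F → ℝ}
    (hpos : ∀ q, 0 < b q) (hb : ContMDiff ((𝓘(ℝ, EB)).prod 𝓘(ℝ, E)) 𝓘(ℝ, ℝ) ∞ b)
    (hmixed : ∀ (x : B) (y : F) (X : EB) (V : E), fderiv ℝ (fderiv ℝ (logInCharts b x y))
      (extChartAt 𝓘(ℝ, EB) x x, extChartAt 𝓘(ℝ, E) y y) (X, 0) (0, V) = 0)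
    (x x₀ : B) (y y₀ : F) : b (x, y) * b (x₀, y₀) = b (x, y₀) * b (x₀, y) := by
  have hφ (x : B) (y : F) : ContDiffAt ℝ 2 (logInCharts b x y)
      (extChartAt 𝓘(ℝ, EB) x x, extChartAt 𝓘(ℝ, E) y y) :=
    (contDiffAt_logInCharts hpos hb x y).of_le (by norm_cast)
  let L (x : B) (y : F) (t : E) : ℝ := Real.log (b (x, (extChartAt 𝓘(ℝ, E) y).symm t))
  have hL (x : B) (y : F) : DifferentiableAt ℝ (L x y) (extChartAt 𝓘(ℝ, E) y y) := by
    have := ((hφ x y).differentiableAt (by decide)).comp (extChartAt 𝓘(ℝ, E) y y)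
      (hasFDerivAt_prodMk_right (𝕜 := ℝ) (extChartAt 𝓘(ℝ, EB) x x)
        (extChartAt 𝓘(ℝ, E) y y)).differentiableAt
    refine this.congr_of_eventuallyEq (Eventually.of_forall fun t ↦ ?_)
    simp [L, logInCharts]
  have hfiber (y : F) (V : E) (x x₀ : B) : fderiv ℝ (L x y) (extChartAt 𝓘(ℝ, E) y y) V =
      fderiv ℝ (L x₀ y) (extChartAt 𝓘(ℝ, E) y y) V := by
    refine eq_of_hasFDerivAt_extChartAt_zero (E := EB)
      (f := fun x ↦ fderiv ℝ (L x y) (extChartAt 𝓘(ℝ, E) y y) V) (fun x ↦ ?_) x x₀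
    refine (hasFDerivAt_fderiv_apply_zero_prod (hφ x y) V).congr_fderiv ?_
    ext X
    simpa using hmixed x y X V
  have hlog : Real.log (b (x, y)) - Real.log (b (x₀, y)) =
      Real.log (b (x, y₀)) - Real.log (b (x₀, y₀)) := by
    refine eq_of_hasFDerivAt_extChartAt_zero (E := E)
      (f := fun y ↦ Real.log (b (x, y)) - Real.log (b (x₀, y))) (fun y ↦ ?_) y y₀
    refine ((hL x y).hasFDerivAt.sub (hL x₀ y).hasFDerivAt).congr_fderiv ?_
    ext V
    exact sub_eq_zero.2 (hfiber y V x x₀)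
  have h' : Real.log (b (x, y) * b (x₀, y₀)) = Real.log (b (x, y₀) * b (x₀, y)) := by
    rw [Real.log_mul (hpos _).ne' (hpos _).ne', Real.log_mul (hpos _).ne' (hpos _).ne']
    linarith
  exact Real.log_injOn_pos (mul_pos (hpos _) (hpos _)) (mul_pos (hpos _) (hpos _)) h'

/-- Conversely, the mixed second derivatives vanish for a function on the base. -/
theorem mixed_logInCharts_base {β : B → ℝ} (hpos : ∀ x, 0 < β x)
    (hβ : ContMDiff 𝓘(ℝ, EB) 𝓘(ℝ, ℝ) ∞ β) (x : B) (y : F) (X : EB) (V : E) :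
    fderiv ℝ (fderiv ℝ (logInCharts (fun q : B × F ↦ β q.1) x y))
      (extChartAt 𝓘(ℝ, EB) x x, extChartAt 𝓘(ℝ, E) y y) (X, 0) (0, V) = 0 := by
  have h := hasFDerivAt_fderiv_apply_zero_prod
    ((contDiffAt_logInCharts (EB := EB) (E' := E) (b := fun q : B × F ↦ β q.1) (fun q ↦ hpos q.1)
      (hβ.comp contMDiff_fst) x y).of_le (m := 2) (by norm_cast)) V
  have h₀ : HasFDerivAt (fun s ↦ fderiv ℝ
      (fun t ↦ logInCharts (EB := EB) (fun q : B × F ↦ β q.1) x y (s, t))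
      (extChartAt 𝓘(ℝ, E) y y) V) (0 : EB →L[ℝ] ℝ) (extChartAt 𝓘(ℝ, EB) x x) := by
    refine (hasFDerivAt_const (0 : ℝ) _).congr_of_eventuallyEq (Eventually.of_forall fun s ↦ ?_)
    simp [logInCharts]
  simpa using DFunLike.congr_fun (h.unique h₀) X

/-- The rescaling of a pseudo-Riemannian metric by a nowhere vanishing smooth function. -/
def PseudoRiemannianMetric.rescale (g : PseudoRiemannianMetric 𝓘(ℝ, E) F) (c : F → ℝ)
    (hc : ∀ y, c y ≠ 0) (hs : ContMDiff 𝓘(ℝ, E) 𝓘(ℝ, ℝ) ∞ c) :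
    PseudoRiemannianMetric 𝓘(ℝ, E) F where
  val y := c y • g.val y
  symm y v w := congrArg (c y * ·) (g.symm y v w)
  nondegenerate y v hv := g.nondegenerate y v fun w ↦ (mul_eq_zero.1 (hv w)).resolve_left (hc y)
  contMDiff := hs.smul_section g.contMDiff

end Splitting

section Main

variable {m : ℕ}
  {EB : Type*} [NormedAddCommGroup EB] [NormedSpace ℝ EB]
  {B : Type*} [TopologicalSpace B] [ChartedSpace EB B]
  {E : Fin m → Type*} [∀ i, NormedAddCommGroup (E i)] [∀ i, NormedSpace ℝ (E i)]
  {F : Fin m → Type*} [∀ i, TopologicalSpace (F i)] [∀ i, ChartedSpace (E i) (F i)]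

theorem sumForm_base_fiber (GB : EB →L[ℝ] EB →L[ℝ] ℝ) (G : ∀ i, E i →L[ℝ] E i →L[ℝ] ℝ)
    (c : Fin m → ℝ) (X : EB) (W : ∀ i, E i) : sumForm GB G c (X, 0) (0, W) = 0 := by
  simp [sumForm_apply]

theorem IsEinstein.isMixedRicciFlat {gB : BilinField 𝓘(ℝ, EB) B}
    {gF : ∀ i, BilinField 𝓘(ℝ, E i) (F i)} {b : ∀ i, B × F i → ℝ}
    (h : IsEinstein (twistedMetric gB gF b)) : IsMixedRicciFlat (twistedMetric gB gF b) := by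
  obtain ⟨c, hc⟩ := h
  intro p (X : EB) i (V : E i)
  have : twistedMetric gB gF b p ((X, 0) : EB × ∀ i, E i)
      ((0, Pi.single i V) : EB × ∀ i, E i) = 0 :=
    sumForm_base_fiber _ _ _ X _
  exact (hc _ _ _).trans (mul_eq_zero_of_right c this)

variable [FiniteDimensional ℝ EB] [IsManifold 𝓘(ℝ, EB) ∞ B] [∀ i, FiniteDimensional ℝ (E i)]
  [∀ i, IsManifold 𝓘(ℝ, E i) ∞ (F i)]

theorem IsMultiplyWarped.isMixedRicciFlat {gB : PseudoRiemannianMetric 𝓘(ℝ, EB) B}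
    {g : BilinField (prodModel EB E) (B × ∀ i, F i)} (hg : IsMultiplyWarped gB g) :
    IsMixedRicciFlat g := by
  obtain ⟨β, h, hpos, hβ, rfl⟩ := hg
  intro p (X : EB) i (V : E i)
  refine (ricci_twistedMetric_mixed gB h (fun i q ↦ hpos i q.1)
    (fun i ↦ (hβ i).comp contMDiff_fst) p X i V).trans ?_
  exact mul_eq_zero_of_right _ (mixed_logInCharts_base (F := F i) (hpos i) (hβ i) p.1 (p.2 i) X V)

theorem IsMixedRicciFlat.isMultiplyWarped [ConnectedSpace B] [∀ i, ConnectedSpace (F i)]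
    (hdim : ∀ i, 1 < Module.finrank ℝ (E i)) (gB : PseudoRiemannianMetric 𝓘(ℝ, EB) B)
    (gF : ∀ i, PseudoRiemannianMetric 𝓘(ℝ, E i) (F i)) {b : ∀ i, B × F i → ℝ}
    (hpos : ∀ i q, 0 < b i q)
    (hb : ∀ i, ContMDiff ((𝓘(ℝ, EB)).prod 𝓘(ℝ, E i)) 𝓘(ℝ, ℝ) ∞ (b i))
    (hflat : IsMixedRicciFlat (twistedMetric gB.val (fun i ↦ (gF i).val) b)) :
    IsMultiplyWarped gB (twistedMetric gB.val (fun i ↦ (gF i).val) b) := by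
  obtain ⟨x₀⟩ : Nonempty B := inferInstance
  let y₀ : ∀ i, F i := fun i ↦ Classical.arbitrary (F i)
  have hsplit (i : Fin m) (x : B) (y : F i) :
      b i (x, y) * b i (x₀, y₀ i) = b i (x, y₀ i) * b i (x₀, y) := by
    refine twist_split (hpos i) (hb i) (fun x y X V ↦ ?_) x x₀ y (y₀ i)
    have h := hflat (x, Function.update y₀ i y) X i V
    rw [ricci_twistedMetric_mixed gB gF hpos hb] at h
    have hd : (Module.finrank ℝ (E i) : ℝ) - 1 ≠ 0 :=
      sub_ne_zero.2 (by exact_mod_cast (hdim i).ne')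
    simpa using (mul_eq_zero.1 h).resolve_left hd
  refine ⟨fun i x ↦ b i (x, y₀ i) * (b i (x₀, y₀ i))⁻¹, fun i ↦ (gF i).rescale
    (fun y ↦ b i (x₀, y) ^ 2) (fun y ↦ (pow_pos (hpos i _) 2).ne') ?_, fun i x ↦ ?_, fun i ↦ ?_, ?_⟩
  · exact ((hb i).comp (contMDiff_const.prodMk contMDiff_id)).pow 2
  · exact mul_pos (hpos i _) (inv_pos.2 (hpos i _))
  · exact ((hb i).comp (contMDiff_id.prodMk contMDiff_const)).mul contMDiff_const
  · funext p
    refine ContinuousLinearMap.ext fun u ↦ ContinuousLinearMap.ext fun v ↦ ?_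
    refine (sumForm_apply _ _ _ _ _).trans (Eq.trans ?_ (sumForm_apply _ _ _ _ _).symm)
    congr 1
    refine Finset.sum_congr rfl fun i _ ↦ ?_
    have hne := (hpos i (x₀, y₀ i)).ne'
    have hbi : b i (p.1, p.2 i) =
        b i (p.1, y₀ i) * (b i (x₀, y₀ i))⁻¹ * b i (x₀, p.2 i) := by
      field_simp
      exact hsplit i p.1 (p.2 i)
    rw [hbi, mul_pow, mul_assoc]
    rfl

end Main

end TwistedProduct

end
theorem corollary2p6 {m : ℕ}
    {EB : Type*} [NormedAddCommGroup EB] [NormedSpace ℝ EB] [FiniteDimensional ℝ EB]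
    {B : Type*} [TopologicalSpace B] [ChartedSpace EB B] [IsManifold 𝓘(ℝ, EB) ∞ B]
    [ConnectedSpace B]
    {E : Fin m → Type*} [∀ i, NormedAddCommGroup (E i)] [∀ i, NormedSpace ℝ (E i)]
    [∀ i, FiniteDimensional ℝ (E i)]
    {F : Fin m → Type*} [∀ i, TopologicalSpace (F i)] [∀ i, ChartedSpace (E i) (F i)]
    [∀ i, IsManifold 𝓘(ℝ, E i) ∞ (F i)] [∀ i, ConnectedSpace (F i)]
    (hdim : ∀ i, 1 < Module.finrank ℝ (E i))
    (gB : TwistedProduct.PseudoRiemannianMetric 𝓘(ℝ, EB) B)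
    (gF : ∀ i, TwistedProduct.PseudoRiemannianMetric 𝓘(ℝ, E i) (F i))
    (b : ∀ i, B × F i → ℝ) (hpos : ∀ i q, 0 < b i q)
    (hb : ∀ i, ContMDiff ((𝓘(ℝ, EB)).prod 𝓘(ℝ, E i)) 𝓘(ℝ, ℝ) ∞ (b i)) :
    (TwistedProduct.IsMixedRicciFlat
        (TwistedProduct.twistedMetric gB.val (fun i ↦ (gF i).val) b) ↔
      TwistedProduct.IsMultiplyWarped gB
        (TwistedProduct.twistedMetric gB.val (fun i ↦ (gF i).val) b)) ∧
    (TwistedProduct.IsEinstein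
        (TwistedProduct.twistedMetric gB.val (fun i ↦ (gF i).val) b) →
      TwistedProduct.IsMultiplyWarped gB
        (TwistedProduct.twistedMetric gB.val (fun i ↦ (gF i).val) b)) := by
  have hwarped := TwistedProduct.IsMixedRicciFlat.isMultiplyWarped hdim gB gF hpos hb
  exact ⟨⟨hwarped, TwistedProduct.IsMultiplyWarped.isMixedRicciFlat⟩,
    fun h ↦ hwarped h.isMixedRicciFlat⟩
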